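/- **Lemma (BIAS-OFUL, expected regret with fixed bias).** Let $T,d\ge 1$ be integers, $w^*,h\in\mathbb R^d$ with $\|w^*\|_2,\|h\|_2\le S$, $\lambda\ge 1$ and $R\ge 0$. At each round $t=1,\dots,T$ the learner receives a (possibly random) decision set $\mathcal D_t\subseteq\mathbb R^d$, picks an arm $x_t\in\mathcal D_t$ and observes $y_t=x_t^\top w^*+\eta_t$. Here, for a filtration $(\mathcal F_t)_{t\ge 0}$, $x_t$ is $\mathcal F_{t-1}$-measurable, $\eta_t$ is $\mathcal F_t$-measurable and conditionally $R$-sub-Gaussian, i.e. $\mathbb E[e^{s\eta_t}\mid\mathcal F_{t-1}]\le e^{s^2R^2/2}$ a.s. for all $s\in\mathbb R$. Assume that $\|x\|_2\le L$ and $x^\top w^*\in[-1,1]$ for all $t$ and all $x\in\mathcal D_t$, and that an optimal arm $x_t^*\in\arg\max_{x\in\mathcal D_t}x^\top w^*$ exists. Let $X_t$ be the matrix with rows $x_1^\top,\dots,x_t^\top$, $Y_t=(y_1,\dots,y_t)^\top$, $V_t=\lambda I+X_t^\top X_t$, $$\widehat w_t=V_t^{-1}X_t^\top(Y_t-X_th)+h,\qquad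 \beta_t(\delta)=\lambda^{1/2}\|h-w^*\|_2+R\sqrt{2\log\frac{\det(V_t)^{1/2}}{\det(\lambda I)^{1/2}\,\delta}}.$$ Suppose that the arms are chosen by BIAS-OFUL with fixed bias $h$ and $\delta=1/T$: for every $t\le T$ (with any tie-breaking), $$x_t\in\arg\max_{x\in\mathcal D_t}\Big\{x^\top\widehat w_{t-1}+\beta_{t-1}(1/T)\,\sqrt{x^\top V_{t-1}^{-1}x}\Big\}.$$ Then the pseudo-regret $R(T,w^*)=\sum_{t=1}^T(x_t^*-x_t)^\top w^*$ is integrable and $$\mathbb E\big[R(T,w^*)\big]\le C_L\sqrt{Td\log\Big(1+\frac{TL}{\lambda d}\Big)}\;\Big(\lambda^{1/2}\|w^*-h\|_2+R\sqrt{d\log\Big(T+\frac{T^2L}{\lambda d}\Big)}\Big),$$ where the constant factor $C_L=C\max\{1,L\}^2$ depends only on the bound $L$ on the norms of the arms, and $C>0$ is an absolute constant (so that $C_L=C$ is absolute whenever $L\le 1$). -/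

import Mathlib

open MeasureTheory ProbabilityTheory
open scoped Matrix

noncomputable section

namespace BiasOFUL

/-- A real random variable `η` is `R`-sub-Gaussian conditionally on the sub-σ-algebra `m`:
`E[exp (s η) | m] ≤ exp (s² R² / 2)` almost surely, for every real `s`.
(No standard Borel assumption is made on the sample space.) -/
def CondSubGaussian {Ω : Type*} (m : MeasurableSpace Ω) {mΩ : MeasurableSpace Ω}
    (P : Measure Ω) (η : Ω → ℝ) (R : ℝ) : Prop :=
  ∀ s : ℝ, Integrable (fun ω => Real.exp (s * η ω)) P ∧
    P[fun ω => Real.exp (s * η ω) | m] ≤ᵐ[P] fun _ => Real.exp (s ^ 2 * R ^ 2 / 2)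

variable {d : ℕ}

/-- The matrix `X_t` whose rows are the first `t` arms `x 0, …, x (t - 1)`. -/
def armMatrix (x : ℕ → EuclideanSpace ℝ (Fin d)) (t : ℕ) : Matrix (Fin t) (Fin d) ℝ :=
  Matrix.of fun s i => x s i

/-- The regularized design matrix `V_t = lam I + X_tᵀ X_t`. -/
def designMatrix (lam : ℝ) (x : ℕ → EuclideanSpace ℝ (Fin d)) (t : ℕ) :
    Matrix (Fin d) (Fin d) ℝ :=
  lam • (1 : Matrix (Fin d) (Fin d) ℝ) + (armMatrix x t)ᵀ * armMatrix x t

/-- The ridge estimate with bias `h` after `t` rounds, `V_t⁻¹ X_tᵀ (Y_t - X_t h) + h`, that is, the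
minimizer of `‖X_t w - Y_t‖² + lam ‖w - h‖²`. -/
def biasedEstimate (lam : ℝ) (h : EuclideanSpace ℝ (Fin d))
    (x : ℕ → EuclideanSpace ℝ (Fin d)) (y : ℕ → ℝ) (t : ℕ) : EuclideanSpace ℝ (Fin d) :=
  WithLp.toLp 2 ((designMatrix lam x t)⁻¹ *ᵥ
    ((armMatrix x t)ᵀ *ᵥ ((fun s : Fin t => y s) - armMatrix x t *ᵥ (fun i => h i)))) + h

/-- The weighted norm `‖v‖_A = √(vᵀ A v)`. -/
def weightedNorm (A : Matrix (Fin d) (Fin d) ℝ) (v : EuclideanSpace ℝ (Fin d)) : ℝ :=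
  Real.sqrt ((fun i => v i) ⬝ᵥ (A *ᵥ (fun i => v i)))

/-- The radius of the biased confidence ellipsoid after `t` rounds,
`lam^{1/2} ‖h - w‖ + R √(2 log (det(V_t)^{1/2} / (det(lam I)^{1/2} δ)))`,
where `w` is the true parameter. -/
def confidenceRadius (lam R δ : ℝ) (h w : EuclideanSpace ℝ (Fin d))
    (x : ℕ → EuclideanSpace ℝ (Fin d)) (t : ℕ) : ℝ :=
  Real.sqrt lam * ‖h - w‖ +
    R * Real.sqrt (2 * Real.log (Real.sqrt (designMatrix lam x t).det /
      (Real.sqrt (lam • (1 : Matrix (Fin d) (Fin d) ℝ)).det * δ)))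

/-- The optimistic index of an arm `a` after `t` rounds: the estimated reward of `a` plus the
confidence radius times the norm of `a` weighted by the inverse design matrix. -/
def optimisticIndex (lam R δ : ℝ) (h w : EuclideanSpace ℝ (Fin d))
    (x : ℕ → EuclideanSpace ℝ (Fin d)) (y : ℕ → ℝ) (t : ℕ) (a : EuclideanSpace ℝ (Fin d)) : ℝ :=
  inner ℝ a (biasedEstimate lam h x y t) +
    confidenceRadius lam R δ h w x t * weightedNorm (designMatrix lam x t)⁻¹ a

/-- The arms `x` are chosen by BIAS-OFUL with bias `h` during the first `T` rounds, when the
decision sets are `D` and the rewards are `y`: each arm belongs to the decision set of its round and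
maximizes there the optimistic index computed from the preceding rounds (ties are broken in any way).
Rounds are numbered from `0`, so `t` rounds precede the choice of `x t`. -/
def IsBiasOFULRun (lam R δ : ℝ) (h w : EuclideanSpace ℝ (Fin d)) (T : ℕ)
    (D : ℕ → Set (EuclideanSpace ℝ (Fin d))) (x : ℕ → EuclideanSpace ℝ (Fin d))
    (y : ℕ → ℝ) : Prop :=
  ∀ t < T, x t ∈ D t ∧ IsMaxOn (optimisticIndex lam R δ h w x y t) (D t) (x t)

/-- The pseudo-regret `∑_t (x*_t - x_t)ᵀ w` over `T` rounds. -/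
def pseudoRegret (w : EuclideanSpace ℝ (Fin d)) (T : ℕ)
    (xstar x : ℕ → EuclideanSpace ℝ (Fin d)) : ℝ :=
  ∑ t ∈ Finset.range T, inner ℝ (xstar t - x t) w

end BiasOFUL

end

/-! By optimism, the regret of a round is at most twice the confidence radius times the width of the
chosen arm in the norm of V_t⁻¹ (`inner_sub_le_of_isMaxOn`). Cauchy–Schwarz over the rounds and the
elliptical potential bound `sum_weightedNorm_sq_le` control the sum of the widths.

The noise is not treated through a good event. Let S_t be the noise vector, scaled to R = 1. The
process M_t = exp(‖S_t‖²/2) (det(lam I)/det V_t)^{1/2}, with the norm of V_t⁻¹, has expectation at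
most 1 (`lintegral_selfNormalizedExp_le_one`): each of its factors is a one-dimensional Gaussian
mixture of the functions exp(g η), and sub-Gaussianity applies at every fixed g. The elementary
inequality `le_sqrt_add_selfNormalizedExp` bounds ‖S_t‖ by the noise part of the radius plus M_t/T
on every outcome. So the confidence bound fails by an excess of mean at most R/T per round, and
neither a union bound nor a maximal inequality is needed. `sum_ite_le_mul_sqrt` and
`div_sqrt_le_max_sq_mul_sqrt` absorb the total excess into the main term. -/

namespace BiasOFUL

/-! ### Rank-one updates of positive definite matrices -/

section RankOneUpdate

variable {n : Type*} [Fintype n] [DecidableEq n]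

lemma dotProduct_inv_mulVec_comm {V : Matrix n n ℝ} (hV : V.IsHermitian) (a b : n → ℝ) :
    a ⬝ᵥ (V⁻¹ *ᵥ b) = b ⬝ᵥ (V⁻¹ *ᵥ a) := by
  have h : (V⁻¹)ᵀ = V⁻¹ := by
    have := hV.inv
    rwa [Matrix.IsHermitian, Matrix.conjTranspose_eq_transpose_of_trivial] at this
  rw [Matrix.dotProduct_mulVec, ← Matrix.mulVec_transpose, h, dotProduct_comm]

lemma dotProduct_inv_mulVec_nonneg {V : Matrix n n ℝ} (hV : V.PosDef) (a : n → ℝ) :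
    0 ≤ a ⬝ᵥ (V⁻¹ *ᵥ a) := by
  simpa using hV.inv.posSemidef.dotProduct_mulVec_nonneg a

/-- The Cauchy–Schwarz inequality for the inner product given by the inverse of a positive definite
matrix. -/
lemma dotProduct_inv_mulVec_le {V : Matrix n n ℝ} (hV : V.PosDef) (a b : n → ℝ) :
    a ⬝ᵥ (V⁻¹ *ᵥ b) ≤ √(a ⬝ᵥ (V⁻¹ *ᵥ a)) * √(b ⬝ᵥ (V⁻¹ *ᵥ b)) := by
  rw [← Real.sqrt_mul (dotProduct_inv_mulVec_nonneg hV a)]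
  apply Real.le_sqrt_of_sq_le
  -- The form at `t • a + b` is a nonnegative quadratic in `t`, so its discriminant is at most 0.
  have h : ∀ t : ℝ, 0 ≤ (a ⬝ᵥ (V⁻¹ *ᵥ a)) * (t * t) + (2 * (a ⬝ᵥ (V⁻¹ *ᵥ b))) * t +
      b ⬝ᵥ (V⁻¹ *ᵥ b) := by
    intro t
    have := dotProduct_inv_mulVec_nonneg hV (t • a + b)
    simp only [Matrix.mulVec_add, Matrix.mulVec_smul, dotProduct_add, add_dotProduct,
      smul_dotProduct, dotProduct_smul, smul_eq_mul,
      dotProduct_inv_mulVec_comm hV.isHermitian b a] at this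
    linarith
  have := discrim_le_zero h
  rw [discrim] at this
  nlinarith

omit [DecidableEq n] in
lemma posDef_add_vecMulVec {V : Matrix n n ℝ} (hV : V.PosDef) (x : n → ℝ) :
    (V + Matrix.vecMulVec x x).PosDef :=
  hV.add_posSemidef (by simpa using Matrix.posSemidef_vecMulVec_self_star x)

/-- The matrix determinant lemma. It makes the squared width of an arm visible as a relative growth
of the determinant. -/
lemma det_add_vecMulVec {V : Matrix n n ℝ} (hV : V.PosDef) (x : n → ℝ) :
    (V + Matrix.vecMulVec x x).det = V.det * (1 + x ⬝ᵥ (V⁻¹ *ᵥ x)) := by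
  have hu : IsUnit V.det := hV.det_pos.ne'.isUnit
  rw [Matrix.vecMulVec_eq Unit, Matrix.det_add_replicateCol_mul_replicateRow hu]
  congr 1
  simp [Matrix.det_unique, Matrix.mul_apply, dotProduct, Matrix.mulVec,
    Finset.mul_sum, Finset.sum_mul]
  rw [Finset.sum_comm]
  simp only [mul_assoc]

/-- The Sherman–Morrison formula. -/
lemma inv_add_vecMulVec_mulVec {V : Matrix n n ℝ} (hV : V.PosDef) (x y : n → ℝ) :
    (V + Matrix.vecMulVec x x)⁻¹ *ᵥ y =
      V⁻¹ *ᵥ y - ((x ⬝ᵥ (V⁻¹ *ᵥ y)) / (1 + x ⬝ᵥ (V⁻¹ *ᵥ x))) • (V⁻¹ *ᵥ x) := by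
  have hu : IsUnit V.det := hV.det_pos.ne'.isUnit
  have hu' := (posDef_add_vecMulVec hV x).det_pos.ne'.isUnit
  have hq := dotProduct_inv_mulVec_nonneg hV x
  have hV1 : ∀ z, V *ᵥ (V⁻¹ *ᵥ z) = z := fun z => by
    rw [Matrix.mulVec_mulVec, Matrix.mul_nonsing_inv _ hu, Matrix.one_mulVec]
  have key : (V + Matrix.vecMulVec x x) *ᵥ (V⁻¹ *ᵥ y -
      ((x ⬝ᵥ (V⁻¹ *ᵥ y)) / (1 + x ⬝ᵥ (V⁻¹ *ᵥ x))) • (V⁻¹ *ᵥ x)) = y := by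
    rw [Matrix.add_mulVec, Matrix.mulVec_sub, Matrix.mulVec_smul, hV1, hV1,
      Matrix.vecMulVec_mulVec, dotProduct_sub, dotProduct_smul]
    ext i
    simp
    field_simp
    ring
  conv_lhs => rw [← key]
  rw [Matrix.mulVec_mulVec, Matrix.nonsing_inv_mul _ hu', Matrix.one_mulVec]

lemma dotProduct_inv_add_vecMulVec_mulVec {V : Matrix n n ℝ} (hV : V.PosDef) (x y : n → ℝ) :
    y ⬝ᵥ ((V + Matrix.vecMulVec x x)⁻¹ *ᵥ y) =
      y ⬝ᵥ (V⁻¹ *ᵥ y) - (x ⬝ᵥ (V⁻¹ *ᵥ y)) ^ 2 / (1 + x ⬝ᵥ (V⁻¹ *ᵥ x)) := by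
  rw [inv_add_vecMulVec_mulVec hV, dotProduct_sub, dotProduct_smul,
    dotProduct_inv_mulVec_comm hV.isHermitian y x, smul_eq_mul]
  ring

/-- How `‖S‖²_{V⁻¹}` changes when `V` becomes `V + x xᵀ` and `S` becomes `S + e x`. -/
lemma dotProduct_inv_add_vecMulVec_mulVec_add_smul {V : Matrix n n ℝ} (hV : V.PosDef)
    (x S : n → ℝ) (e : ℝ) :
    (S + e • x) ⬝ᵥ ((V + Matrix.vecMulVec x x)⁻¹ *ᵥ (S + e • x)) =
      S ⬝ᵥ (V⁻¹ *ᵥ S) + (2 * e * (x ⬝ᵥ (V⁻¹ *ᵥ S)) + e ^ 2 * (x ⬝ᵥ (V⁻¹ *ᵥ x)) -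
        (x ⬝ᵥ (V⁻¹ *ᵥ S)) ^ 2) / (1 + x ⬝ᵥ (V⁻¹ *ᵥ x)) := by
  have hq := dotProduct_inv_mulVec_nonneg hV x
  rw [dotProduct_inv_add_vecMulVec_mulVec hV]
  simp only [Matrix.mulVec_add, Matrix.mulVec_smul, dotProduct_add, add_dotProduct,
      smul_dotProduct, dotProduct_smul, smul_eq_mul,
      dotProduct_inv_mulVec_comm hV.isHermitian S x]
  field_simp
  ring

/-- The AM–GM inequality for the eigenvalues. -/
lemma det_le_pow_trace_div_card [Nonempty n] {V : Matrix n n ℝ} (hV : V.PosDef) :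
    V.det ≤ (V.trace / Fintype.card n) ^ Fintype.card n := by
  have hH := hV.isHermitian
  have hc : (0 : ℝ) < Fintype.card n := by exact_mod_cast Fintype.card_pos
  have h0 : ∀ i, 0 ≤ hH.eigenvalues i := fun i => (hV.eigenvalues_pos i).le
  have := Real.geom_mean_le_arith_mean Finset.univ (fun _ : n => (1 : ℝ)) hH.eigenvalues
    (fun _ _ => zero_le_one) (by simpa using hc) (fun i _ => h0 i)
  simp only [Real.rpow_one, Finset.sum_const, Finset.card_univ, nsmul_eq_mul, mul_one,
    one_mul] at this
  have hdet : V.det = ∏ i, hH.eigenvalues i := by simpa using hH.det_eq_prod_eigenvalues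
  have htr : V.trace = ∑ i, hH.eigenvalues i := by simpa using hH.trace_eq_sum_eigenvalues
  rw [← hdet, ← htr] at this
  calc V.det = (V.det ^ ((Fintype.card n : ℝ)⁻¹)) ^ Fintype.card n := by
        rw [← Real.rpow_natCast, ← Real.rpow_mul hV.det_pos.le, inv_mul_cancel₀ hc.ne',
          Real.rpow_one]
    _ ≤ _ := pow_le_pow_left₀ (Real.rpow_nonneg hV.det_pos.le _) this _

end RankOneUpdate

/-! ### The design matrix and its determinant -/

section DesignMatrix

variable {d : ℕ} {lam : ℝ} {x : ℕ → EuclideanSpace ℝ (Fin d)}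

lemma designMatrix_apply (lam : ℝ) (x : ℕ → EuclideanSpace ℝ (Fin d)) (t : ℕ) (i j : Fin d) :
    designMatrix lam x t i j =
      lam * (1 : Matrix (Fin d) (Fin d) ℝ) i j + ∑ s ∈ Finset.range t, x s i * x s j := by
  simp [designMatrix, armMatrix, Matrix.mul_apply, Finset.sum_range]

lemma designMatrix_zero (lam : ℝ) (x : ℕ → EuclideanSpace ℝ (Fin d)) :
    designMatrix lam x 0 = lam • (1 : Matrix (Fin d) (Fin d) ℝ) := by
  ext i j
  simp [designMatrix_apply]

lemma designMatrix_succ (lam : ℝ) (x : ℕ → EuclideanSpace ℝ (Fin d)) (t : ℕ) :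
    designMatrix lam x (t + 1) =
      designMatrix lam x t + Matrix.vecMulVec (x t).ofLp (x t).ofLp := by
  ext i j
  simp [designMatrix_apply, Finset.sum_range_succ, Matrix.vecMulVec_apply, add_assoc]

lemma designMatrix_posDef (hlam : 0 < lam) (x : ℕ → EuclideanSpace ℝ (Fin d)) (t : ℕ) :
    (designMatrix lam x t).PosDef := by
  induction t with
  | zero =>
    rw [designMatrix_zero]
    exact Matrix.PosDef.one.smul hlam
  | succ t ih =>
    rw [designMatrix_succ]
    exact posDef_add_vecMulVec ih _

lemma inv_designMatrix_zero (hlam : 0 < lam) (x : ℕ → EuclideanSpace ℝ (Fin d)) :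
    (designMatrix lam x 0)⁻¹ = lam⁻¹ • (1 : Matrix (Fin d) (Fin d) ℝ) := by
  rw [designMatrix_zero]
  apply Matrix.inv_eq_left_inv
  simp [smul_smul, hlam.ne']

lemma dotProduct_self_eq_norm_sq (a : EuclideanSpace ℝ (Fin d)) : a.ofLp ⬝ᵥ a.ofLp = ‖a‖ ^ 2 := by
  rw [EuclideanSpace.real_norm_sq_eq]
  simp [dotProduct, sq]

lemma inner_eq_dotProduct (a b : EuclideanSpace ℝ (Fin d)) : inner ℝ a b = a.ofLp ⬝ᵥ b.ofLp := by
  simp [PiLp.inner_apply, dotProduct, mul_comm]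

lemma weightedNorm_inv_sq (hlam : 0 < lam) (t : ℕ) (a : EuclideanSpace ℝ (Fin d)) :
    weightedNorm (designMatrix lam x t)⁻¹ a ^ 2 =
      a.ofLp ⬝ᵥ ((designMatrix lam x t)⁻¹ *ᵥ a.ofLp) :=
  Real.sq_sqrt (dotProduct_inv_mulVec_nonneg (designMatrix_posDef hlam x t) _)

lemma weightedNorm_nonneg (A : Matrix (Fin d) (Fin d) ℝ) (a : EuclideanSpace ℝ (Fin d)) :
    0 ≤ weightedNorm A a := Real.sqrt_nonneg _

/-- By Sherman–Morrison each round only subtracts a nonnegative term from the initial value, which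
is the right-hand side. -/
lemma dotProduct_inv_designMatrix_le (hlam : 0 < lam) (t : ℕ) (a : EuclideanSpace ℝ (Fin d)) :
    a.ofLp ⬝ᵥ ((designMatrix lam x t)⁻¹ *ᵥ a.ofLp) ≤ ‖a‖ ^ 2 / lam := by
  induction t with
  | zero =>
    rw [inv_designMatrix_zero hlam]
    simp only [Matrix.smul_mulVec, Matrix.one_mulVec, dotProduct_smul, smul_eq_mul,
      dotProduct_self_eq_norm_sq]
    rw [div_eq_inv_mul]
  | succ t ih =>
    rw [designMatrix_succ, dotProduct_inv_add_vecMulVec_mulVec (designMatrix_posDef hlam x t)]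
    have hq := dotProduct_inv_mulVec_nonneg (designMatrix_posDef hlam x t) (x t).ofLp
    have : 0 ≤ ((x t).ofLp ⬝ᵥ ((designMatrix lam x t)⁻¹ *ᵥ a.ofLp)) ^ 2 /
      (1 + (x t).ofLp ⬝ᵥ ((designMatrix lam x t)⁻¹ *ᵥ (x t).ofLp)) := by positivity
    linarith

lemma weightedNorm_inv_designMatrix_le (hlam : 0 < lam) (t : ℕ) (a : EuclideanSpace ℝ (Fin d)) :
    weightedNorm (designMatrix lam x t)⁻¹ a ≤ ‖a‖ / √lam := by
  refine (Real.sqrt_le_sqrt (dotProduct_inv_designMatrix_le hlam t a)).trans_eq ?_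
  rw [Real.sqrt_div (sq_nonneg _), Real.sqrt_sq (norm_nonneg _)]

/-- The ratio `det V_t / det (lam I)`. -/
noncomputable def detRatio (lam : ℝ) (x : ℕ → EuclideanSpace ℝ (Fin d)) (t : ℕ) : ℝ :=
  (designMatrix lam x t).det / (lam • (1 : Matrix (Fin d) (Fin d) ℝ)).det

lemma det_smul_one_pos (hlam : 0 < lam) : 0 < (lam • (1 : Matrix (Fin d) (Fin d) ℝ)).det := by
  simpa using pow_pos hlam _

lemma detRatio_pos (hlam : 0 < lam) (t : ℕ) : 0 < detRatio lam x t :=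
  div_pos (designMatrix_posDef hlam x t).det_pos (det_smul_one_pos hlam)

lemma detRatio_zero (hlam : 0 < lam) : detRatio lam x 0 = 1 := by
  rw [detRatio, designMatrix_zero, div_self (det_smul_one_pos hlam).ne']

lemma detRatio_succ (hlam : 0 < lam) (t : ℕ) :
    detRatio lam x (t + 1) =
      detRatio lam x t * (1 + (x t).ofLp ⬝ᵥ ((designMatrix lam x t)⁻¹ *ᵥ (x t).ofLp)) := by
  rw [detRatio, designMatrix_succ, det_add_vecMulVec (designMatrix_posDef hlam x t), detRatio]
  ring

/-- The determinant factors telescope. The summands are nonnegative, so this also yields the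
monotonicity of the log-determinant. -/
lemma sum_log_one_add_eq_log_detRatio (hlam : 0 < lam) (t : ℕ) :
    ∑ s ∈ Finset.range t,
      Real.log (1 + (x s).ofLp ⬝ᵥ ((designMatrix lam x s)⁻¹ *ᵥ (x s).ofLp)) =
      Real.log (detRatio lam x t) := by
  induction t with
  | zero => simp [detRatio_zero hlam]
  | succ t ih =>
    have hq := dotProduct_inv_mulVec_nonneg (designMatrix_posDef hlam x t) (x t).ofLp
    rw [Finset.sum_range_succ, ih, detRatio_succ hlam,
      Real.log_mul (detRatio_pos hlam t).ne' (by positivity)]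

lemma log_detRatio_mono (hlam : 0 < lam) {s t : ℕ} (h : s ≤ t) :
    Real.log (detRatio lam x s) ≤ Real.log (detRatio lam x t) := by
  rw [← sum_log_one_add_eq_log_detRatio hlam, ← sum_log_one_add_eq_log_detRatio hlam]
  refine Finset.sum_le_sum_of_subset_of_nonneg (Finset.range_mono h) fun i _ _ => ?_
  have hq := dotProduct_inv_mulVec_nonneg (designMatrix_posDef hlam x i) (x i).ofLp
  exact Real.log_nonneg (by linarith)

lemma one_le_detRatio (hlam : 0 < lam) (t : ℕ) : 1 ≤ detRatio lam x t := by
  have := log_detRatio_mono (x := x) hlam (Nat.zero_le t)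
  rw [detRatio_zero hlam, Real.log_one] at this
  exact (Real.log_nonneg_iff (detRatio_pos hlam t)).1 this

lemma trace_designMatrix (lam : ℝ) (x : ℕ → EuclideanSpace ℝ (Fin d)) (t : ℕ) :
    (designMatrix lam x t).trace = lam * d + ∑ s ∈ Finset.range t, ‖x s‖ ^ 2 := by
  induction t with
  | zero => simp [designMatrix_zero, Matrix.trace_smul]
  | succ t ih =>
    rw [designMatrix_succ, Matrix.trace_add, ih, Matrix.trace_vecMulVec,
      dotProduct_self_eq_norm_sq, Finset.sum_range_succ]
    ring

/-- The determinant-trace bound on the growth of the design matrix. -/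
lemma log_detRatio_le (hd : 1 ≤ d) (hlam : 0 < lam) {L : ℝ} {t : ℕ}
    (hx : ∀ s < t, ‖x s‖ ≤ L) :
    Real.log (detRatio lam x t) ≤ d * Real.log (1 + t * L ^ 2 / (lam * d)) := by
  have : Nonempty (Fin d) := ⟨⟨0, hd⟩⟩
  have hd' : (0 : ℝ) < d := by exact_mod_cast hd
  have hsum : ∑ s ∈ Finset.range t, ‖x s‖ ^ 2 ≤ t * L ^ 2 := by
    refine (Finset.sum_le_card_nsmul _ _ (L ^ 2) fun s hs => ?_).trans_eq (by simp)
    exact pow_le_pow_left₀ (norm_nonneg _) (hx s (Finset.mem_range.1 hs)) 2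
  have hdet := det_le_pow_trace_div_card (designMatrix_posDef hlam x t)
  rw [trace_designMatrix, Fintype.card_fin] at hdet
  have h2 : detRatio lam x t ≤ (1 + t * L ^ 2 / (lam * d)) ^ d := by
    rw [detRatio, div_le_iff₀ (det_smul_one_pos hlam)]
    refine hdet.trans ?_
    have : (lam • (1 : Matrix (Fin d) (Fin d) ℝ)).det = lam ^ d := by simp
    rw [this, ← mul_pow]
    refine pow_le_pow_left₀ (by positivity) ?_ _
    rw [div_le_iff₀ hd']
    field_simp
    linarith
  calc _ ≤ Real.log ((1 + t * L ^ 2 / (lam * d)) ^ d) := Real.log_le_log (detRatio_pos hlam t) h2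
    _ = _ := Real.log_pow _ _

/-- The confidence radius in terms of the determinant ratio. -/
lemma confidenceRadius_eq (hlam : 0 < lam) (R δ : ℝ) (h w : EuclideanSpace ℝ (Fin d)) (t : ℕ) :
    confidenceRadius lam R δ h w x t =
      √lam * ‖h - w‖ + R * √(2 * Real.log (√(detRatio lam x t) / δ)) := by
  rw [confidenceRadius, detRatio, Real.sqrt_div (designMatrix_posDef hlam x t).det_pos.le,
    div_div]

/-! ### Estimation error and optimism -/

/-- The noise vector `X_tᵀ (η_0, …, η_{t-1})`. -/
def noiseVector (x : ℕ → EuclideanSpace ℝ (Fin d)) (η : ℕ → ℝ) (t : ℕ) :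
    EuclideanSpace ℝ (Fin d) := ∑ s ∈ Finset.range t, η s • x s

lemma noiseVector_succ (η : ℕ → ℝ) (t : ℕ) :
    (noiseVector x η (t + 1)).ofLp = (noiseVector x η t).ofLp + η t • (x t).ofLp := by
  simp [noiseVector, Finset.sum_range_succ]

/-- Substitute Y - X h = X (w - h) + η and XᵀX = V - lam I: the error splits into a noise part and a
shrinkage part towards the bias. -/
lemma biasedEstimate_sub_eq (hlam : 0 < lam) {h w : EuclideanSpace ℝ (Fin d)}
    {η y : ℕ → ℝ} {t : ℕ} (hy : ∀ s < t, y s = inner ℝ (x s) w + η s) :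
    (biasedEstimate lam h x y t - w).ofLp = (designMatrix lam x t)⁻¹ *ᵥ
      (noiseVector x η t - lam • (w - h)).ofLp := by
  have hu : IsUnit (designMatrix lam x t).det := (designMatrix_posDef hlam x t).det_pos.ne'.isUnit
  have hY : (fun s : Fin t => y s) - armMatrix x t *ᵥ (fun i => h i) =
      armMatrix x t *ᵥ (w - h).ofLp + fun s : Fin t => η s := by
    ext s
    simp only [Pi.sub_apply, Pi.add_apply, hy s s.2, inner_eq_dotProduct]
    simp only [WithLp.ofLp_sub, Matrix.mulVec_sub, Pi.sub_apply]
    simp only [Matrix.mulVec, armMatrix, dotProduct, Matrix.of_apply]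
    ring
  have hN : (armMatrix x t)ᵀ *ᵥ (fun s : Fin t => η s) = (noiseVector x η t).ofLp := by
    ext i
    simp [noiseVector, Matrix.mulVec, dotProduct, armMatrix, Finset.sum_range, mul_comm]
  have hG : (armMatrix x t)ᵀ *ᵥ (armMatrix x t *ᵥ (w - h).ofLp) =
      designMatrix lam x t *ᵥ (w - h).ofLp - lam • (w - h).ofLp := by
    rw [designMatrix, Matrix.add_mulVec, Matrix.smul_mulVec, Matrix.one_mulVec,
      Matrix.mulVec_mulVec, add_sub_cancel_left]
  have hinv : (designMatrix lam x t)⁻¹ *ᵥ (designMatrix lam x t *ᵥ (w - h).ofLp) =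
      (w - h).ofLp := by
    rw [Matrix.mulVec_mulVec, Matrix.nonsing_inv_mul _ hu, Matrix.one_mulVec]
  rw [biasedEstimate, hY, Matrix.mulVec_add, hN, hG]
  simp only [WithLp.ofLp_sub, WithLp.ofLp_add, WithLp.ofLp_smul, Matrix.mulVec_add,
    Matrix.mulVec_sub] at hinv ⊢
  rw [hinv]
  abel

/-- The error of the biased ridge estimate in a direction `a`. -/
lemma abs_inner_biasedEstimate_sub_le (hlam : 0 < lam) {h w : EuclideanSpace ℝ (Fin d)}
    {η y : ℕ → ℝ} {t : ℕ} (hy : ∀ s < t, y s = inner ℝ (x s) w + η s)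
    (a : EuclideanSpace ℝ (Fin d)) :
    |inner ℝ a (biasedEstimate lam h x y t - w)| ≤
      weightedNorm (designMatrix lam x t)⁻¹ a *
        (weightedNorm (designMatrix lam x t)⁻¹ (noiseVector x η t) + √lam * ‖h - w‖) := by
  have hV := designMatrix_posDef hlam x t
  have hcs : ∀ a b : EuclideanSpace ℝ (Fin d), |a.ofLp ⬝ᵥ ((designMatrix lam x t)⁻¹ *ᵥ b.ofLp)| ≤
      weightedNorm (designMatrix lam x t)⁻¹ a * weightedNorm (designMatrix lam x t)⁻¹ b := by
    intro a b
    refine abs_le'.2 ⟨dotProduct_inv_mulVec_le hV _ _, ?_⟩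
    have := dotProduct_inv_mulVec_le hV (-a.ofLp) b.ofLp
    simpa [weightedNorm, Matrix.mulVec_neg] using this
  -- Since V⁻¹ ≤ lam⁻¹ I, the bias costs at most the first term of the confidence radius.
  have hlw : weightedNorm (designMatrix lam x t)⁻¹ (w - h) * lam ≤ √lam * ‖h - w‖ := by
    have h1 := weightedNorm_inv_designMatrix_le (x := x) hlam t (w - h)
    have hs := Real.sqrt_pos.2 hlam
    rw [le_div_iff₀ hs, norm_sub_rev] at h1
    calc _ = √lam * (weightedNorm (designMatrix lam x t)⁻¹ (w - h) * √lam) := by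
          nth_rewrite 2 [← Real.mul_self_sqrt hlam.le]
          ring
      _ ≤ _ := by gcongr
  have h1 := hcs a (noiseVector x η t)
  have h2 := hcs a (w - h)
  rw [inner_eq_dotProduct, biasedEstimate_sub_eq hlam hy]
  simp only [WithLp.ofLp_sub, WithLp.ofLp_smul, Matrix.mulVec_sub, Matrix.mulVec_smul,
    dotProduct_sub, dotProduct_smul, smul_eq_mul] at h2 ⊢
  refine (abs_sub _ _).trans ?_
  rw [abs_mul, abs_of_pos hlam]
  have h0 := weightedNorm_nonneg (designMatrix lam x t)⁻¹ a
  have h3 := mul_le_mul_of_nonneg_left h2 hlam.le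
  have h4 := mul_le_mul_of_nonneg_left hlw h0
  linarith

/-- The regret of a single round in which the arm maximizes the optimistic index, when the
confidence radius may fail by the amount `e`. -/
lemma inner_sub_le_of_isMaxOn (hlam : 0 < lam) {R δ e L : ℝ} {h w : EuclideanSpace ℝ (Fin d)}
    {η y : ℕ → ℝ} {t : ℕ} {D : Set (EuclideanSpace ℝ (Fin d))} {a : EuclideanSpace ℝ (Fin d)}
    (hy : ∀ s < t, y s = inner ℝ (x s) w + η s) (he0 : 0 ≤ e)
    (he : weightedNorm (designMatrix lam x t)⁻¹ (noiseVector x η t) ≤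
      R * √(2 * Real.log (√(detRatio lam x t) / δ)) + e)
    (hL : ∀ b ∈ D, ‖b‖ ≤ L) (hxD : x t ∈ D)
    (hmax : IsMaxOn (optimisticIndex lam R δ h w x y t) D (x t)) (ha : a ∈ D) :
    inner ℝ (a - x t) w ≤
      2 * confidenceRadius lam R δ h w x t * weightedNorm (designMatrix lam x t)⁻¹ (x t) +
        2 * e * (L / √lam) := by
  have hmax' := hmax ha
  simp only [Set.mem_ofPred_eq, optimisticIndex] at hmax'
  have h1 := abs_inner_biasedEstimate_sub_le (h := h) hlam hy a
  have h2 := abs_inner_biasedEstimate_sub_le (h := h) hlam hy (x t)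
  set N := weightedNorm (designMatrix lam x t)⁻¹ (noiseVector x η t)
  have hβ := confidenceRadius_eq (x := x) hlam R δ h w t
  set β := confidenceRadius lam R δ h w x t
  have hN : N + √lam * ‖h - w‖ ≤ β + e := by rw [hβ]; linarith
  have hwn : ∀ b ∈ D, weightedNorm (designMatrix lam x t)⁻¹ b ≤ L / √lam := fun b hb =>
    (weightedNorm_inv_designMatrix_le hlam t b).trans (by gcongr; exact hL b hb)
  -- The excess `e` is paired with the deterministic width bound `L / √lam`, so that only E[e] is
  -- needed later.
  have hb : ∀ b ∈ D, weightedNorm (designMatrix lam x t)⁻¹ b * (N + √lam * ‖h - w‖) ≤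
      weightedNorm (designMatrix lam x t)⁻¹ b * β + e * (L / √lam) := fun b hb => by
    have := mul_le_mul_of_nonneg_left hN (weightedNorm_nonneg (designMatrix lam x t)⁻¹ b)
    have := mul_le_mul_of_nonneg_left (hwn b hb) he0
    linarith
  -- Optimism: in the comparison of the two indices the width of `a` cancels, which leaves the width
  -- of `x t` twice.
  have h3 := hb a ha
  have h4 := hb (x t) hxD
  have h5 := (abs_le.1 h1).1
  have h6 := (abs_le.1 h2).2
  rw [inner_sub_right] at h5 h6
  rw [inner_sub_left]
  linarith

end DesignMatrix

/-! ### One step of the exponential supermartingale -/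

section SelfNormalized

variable {Ω : Type*} {m mΩ : MeasurableSpace Ω} {P : Measure Ω}

/-- A conditionally sub-Gaussian variable has sub-Gaussian moment generating function under every
reweighting of the measure by a nonnegative past-measurable function. -/
lemma CondSubGaussian.lintegral_mul_exp_le [IsProbabilityMeasure P] (hm : m ≤ mΩ) {η : Ω → ℝ}
    {R : ℝ} (hη : CondSubGaussian m P η R) (s : ℝ) {W : Ω → ENNReal} (hW : Measurable[m] W) :
    ∫⁻ ω, W ω * ENNReal.ofReal (Real.exp (s * η ω)) ∂P ≤
      (∫⁻ ω, W ω ∂P) * ENNReal.ofReal (Real.exp (s ^ 2 * R ^ 2 / 2)) := by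
  obtain ⟨hint, hle⟩ := hη s
  set f : Ω → ENNReal := fun ω => ENNReal.ofReal (Real.exp (s * η ω)) with hf
  set c : ENNReal := ENNReal.ofReal (Real.exp (s ^ 2 * R ^ 2 / 2)) with hc
  have hfm : AEMeasurable f P := hint.aestronglyMeasurable.aemeasurable.ennreal_ofReal
  -- The conditional bound becomes a domination of measures on `m`, against which any `W` integrates
  -- without integrability conditions.
  have hcomp : (P.withDensity f).trim hm ≤ (c • P).trim hm := by
    refine Measure.le_iff.2 fun A hA => ?_
    rw [trim_measurableSet_eq hm hA, trim_measurableSet_eq hm hA, withDensity_apply _ (hm _ hA),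
      ← ofReal_integral_eq_lintegral_ofReal hint.integrableOn
        (Filter.Eventually.of_forall fun _ => (Real.exp_pos _).le),
      ← setIntegral_condExp hm hint hA, Measure.smul_apply, smul_eq_mul]
    calc _ ≤ ENNReal.ofReal (∫ _ in A, Real.exp (s ^ 2 * R ^ 2 / 2) ∂P) := by
          refine ENNReal.ofReal_le_ofReal ?_
          exact setIntegral_mono_ae integrable_condExp.integrableOn (by simp) hle
      _ = _ := by
          rw [setIntegral_const, smul_eq_mul, ENNReal.ofReal_mul measureReal_nonneg,
            ofReal_measureReal, mul_comm]
  calc _ = ∫⁻ ω, W ω ∂(P.withDensity f) := by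
        rw [lintegral_withDensity_eq_lintegral_mul₀ hfm (hW.mono hm le_rfl).aemeasurable]
        refine lintegral_congr fun ω => ?_
        rw [Pi.mul_apply, mul_comm]
    _ = ∫⁻ ω, W ω ∂((P.withDensity f).trim hm) := (lintegral_trim hm hW).symm
    _ ≤ ∫⁻ ω, W ω ∂((c • P).trim hm) := lintegral_mono' hcomp le_rfl
    _ = _ := by rw [lintegral_trim hm hW, lintegral_smul_measure, smul_eq_mul, mul_comm]

/-- The mean of exp(η) + exp(-η) is at most 2, the pointwise minimum, which is attained only at η =
0. This treats `R = 0`, where the noise cannot be rescaled. -/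
lemma CondSubGaussian.ae_eq_zero [IsProbabilityMeasure P] {η : Ω → ℝ} (hm : m ≤ mΩ)
    (hη : CondSubGaussian m P η 0) : η =ᵐ[P] 0 := by
  have hle : ∀ s : ℝ, ∫ ω, Real.exp (s * η ω) ∂P ≤ 1 := by
    intro s
    obtain ⟨-, h⟩ := hη s
    rw [← integral_condExp hm]
    refine (integral_mono_ae integrable_condExp (by fun_prop) h).trans (by simp)
  have hi1 : Integrable (fun ω => Real.exp (η ω)) P := by simpa using (hη 1).1
  have hi2 : Integrable (fun ω => Real.exp (-η ω)) P := by simpa using (hη (-1)).1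
  have h1 := hle 1
  have h2 := hle (-1)
  simp only [one_mul, neg_mul] at h1 h2
  have hpos : ∀ u : ℝ, 0 ≤ Real.exp u + Real.exp (-u) - 2 := fun u => by
    linarith [Real.add_one_le_exp u, Real.add_one_le_exp (-u)]
  have hi : Integrable (fun ω => Real.exp (η ω) + Real.exp (-η ω) - 2) P :=
    (hi1.add hi2).sub (integrable_const _)
  have hz : ∫ ω, (Real.exp (η ω) + Real.exp (-η ω) - 2) ∂P = 0 := by
    refine le_antisymm ?_ (integral_nonneg fun ω => hpos _)
    rw [integral_sub (f := fun ω => Real.exp (η ω) + Real.exp (-η ω)) (hi1.add hi2)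
      (integrable_const _), integral_add hi1 hi2]
    simp
    linarith
  have := (integral_eq_zero_iff_of_nonneg (fun ω => hpos (η ω)) hi).1 hz
  filter_upwards [this] with ω hω
  by_contra hne
  have := Real.add_one_lt_exp hne
  have := Real.add_one_le_exp (-η ω)
  simp at hω
  linarith

/-- The exponential supermartingale factor as a Gaussian mixture. -/
lemma exp_div_sqrt_eq_lintegral_gaussianPDF {q : ℝ} (hq : 0 < q) (a e : ℝ) :
    ENNReal.ofReal (Real.exp ((2 * e * a + e ^ 2 * q - a ^ 2) / (2 * (1 + q))) / √(1 + q)) =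
      ∫⁻ g, ENNReal.ofReal (gaussianPDFReal a q.toNNReal g) *
        ENNReal.ofReal (Real.exp (-(g ^ 2 / 2))) * ENNReal.ofReal (Real.exp (g * e)) := by
  have hv : 0 < q / (1 + q) := by positivity
  have hv' : (q / (1 + q)).toNNReal ≠ 0 := by simpa using hv
  -- Completing the square in `g`: up to a constant, the integrand is a Gaussian density of variance
  -- q/(1+q).
  have key : ∀ g, gaussianPDFReal a q.toNNReal g * Real.exp (-(g ^ 2 / 2)) * Real.exp (g * e) =
      (Real.exp ((2 * e * a + e ^ 2 * q - a ^ 2) / (2 * (1 + q))) / √(1 + q)) *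
        gaussianPDFReal (q / (1 + q) * (e + a / q)) (q / (1 + q)).toNNReal g := by
    intro g
    have hs : √(2 * Real.pi * (q / (1 + q))) = √(2 * Real.pi * q) / √(1 + q) := by
      rw [← mul_div_assoc, Real.sqrt_div (by positivity)]
    have h1 : √(1 + q) ≠ 0 := by positivity
    have h2 : √(2 * Real.pi * q) ≠ 0 := by positivity
    simp only [gaussianPDFReal, Real.coe_toNNReal _ hq.le, Real.coe_toNNReal _ hv.le, hs]
    rw [mul_assoc, mul_assoc, ← Real.exp_add, ← Real.exp_add]
    have hE : Real.exp (-(g - a) ^ 2 / (2 * q) + (-(g ^ 2 / 2) + g * e)) =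
        Real.exp ((2 * e * a + e ^ 2 * q - a ^ 2) / (2 * (1 + q))) *
          Real.exp (-(g - q / (1 + q) * (e + a / q)) ^ 2 / (2 * (q / (1 + q)))) := by
      rw [← Real.exp_add]
      congr 1
      field_simp
      ring
    rw [hE]
    field_simp
  calc _ = ENNReal.ofReal
          (Real.exp ((2 * e * a + e ^ 2 * q - a ^ 2) / (2 * (1 + q))) / √(1 + q)) *
        ∫⁻ g, ENNReal.ofReal
          (gaussianPDFReal (q / (1 + q) * (e + a / q)) (q / (1 + q)).toNNReal g) := by
        rw [lintegral_gaussianPDFReal_eq_one _ hv', mul_one]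
    _ = _ := by
        rw [← lintegral_const_mul _ (measurable_gaussianPDFReal _ _).ennreal_ofReal]
        refine lintegral_congr fun g => ?_
        rw [← ENNReal.ofReal_mul (by positivity), ← key,
          ← ENNReal.ofReal_mul (gaussianPDFReal_nonneg _ _ _),
          ← ENNReal.ofReal_mul (mul_nonneg (gaussianPDFReal_nonneg _ _ _) (Real.exp_pos _).le)]

/-- One step of the self-normalized exponential supermartingale. -/
lemma CondSubGaussian.lintegral_mul_exp_div_sqrt_le [IsProbabilityMeasure P] (hm : m ≤ mΩ)
    {η : Ω → ℝ} (hη : CondSubGaussian m P η 1) (hηm : Measurable η) {W : Ω → ENNReal}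
    {a q : Ω → ℝ} (hW : Measurable[m] W) (ha : Measurable[m] a) (hq : Measurable[m] q)
    (hq0 : ∀ ω, 0 ≤ q ω) (haq : ∀ ω, q ω = 0 → a ω = 0) :
    ∫⁻ ω, W ω * ENNReal.ofReal (Real.exp
      ((2 * η ω * a ω + η ω ^ 2 * q ω - a ω ^ 2) / (2 * (1 + q ω))) / √(1 + q ω)) ∂P ≤
      ∫⁻ ω, W ω ∂P := by
  have hW' := hW.mono hm le_rfl
  have ha' := ha.mono hm le_rfl
  have hq' := hq.mono hm le_rfl
  have hA : MeasurableSet {ω | q ω = 0} := hq' (measurableSet_singleton 0)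
  have hAm : MeasurableSet[m] {ω | q ω = 0}ᶜ := (hq (measurableSet_singleton 0)).compl
  -- At `q = 0` the mixing density degenerates to the zero function, so that set is split off; there
  -- `a = 0` and the factor equals 1.
  rw [← lintegral_add_compl (fun ω => W ω) hA, ← lintegral_add_compl _ hA]
  refine add_le_add (le_of_eq ?_) ?_
  · refine setLIntegral_congr_fun hA fun ω hω => ?_
    have hω' : q ω = 0 := hω
    simp [hω', haq ω hω']
  set W₁ : Ω → ENNReal := Set.indicator {ω | q ω = 0}ᶜ W with hW₁
  have hW₁m : Measurable[m] W₁ := hW.indicator hAm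
  have hφ : Measurable[(m.prod inferInstance : MeasurableSpace (Ω × ℝ))] fun p : Ω × ℝ =>
      ENNReal.ofReal (gaussianPDFReal (a p.1) (q p.1).toNNReal p.2) := by
    refine Measurable.ennreal_ofReal ?_
    exact measurable_uncurry_gaussianPDFReal.comp
      ((ha.comp measurable_fst).prodMk
        ((hq.comp measurable_fst).real_toNNReal.prodMk measurable_snd))
  have hφ' : Measurable fun p : Ω × ℝ =>
      ENNReal.ofReal (gaussianPDFReal (a p.1) (q p.1).toNNReal p.2) := by
    refine Measurable.ennreal_ofReal ?_
    exact measurable_uncurry_gaussianPDFReal.comp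
      ((ha'.comp measurable_fst).prodMk
        ((hq'.comp measurable_fst).real_toNNReal.prodMk measurable_snd))
  have hW₁m' := hW₁m.mono hm le_rfl
  calc _ = ∫⁻ ω, (∫⁻ g, W₁ ω * (ENNReal.ofReal (gaussianPDFReal (a ω) (q ω).toNNReal g) *
          ENNReal.ofReal (Real.exp (-(g ^ 2 / 2))) * ENNReal.ofReal (Real.exp (g * η ω)))) ∂P := by
        rw [← lintegral_indicator hA.compl]
        refine lintegral_congr fun ω => ?_
        rw [lintegral_const_mul]
        · by_cases h : q ω = 0
          · simp [hW₁, h]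
          · rw [← exp_div_sqrt_eq_lintegral_gaussianPDF (lt_of_le_of_ne (hq0 ω) (Ne.symm h))]
            simp [hW₁, h]
        · exact ((measurable_gaussianPDFReal _ _).ennreal_ofReal.mul (by fun_prop)).mul
            (by fun_prop)
    _ = ∫⁻ g, ∫⁻ ω, W₁ ω * (ENNReal.ofReal (gaussianPDFReal (a ω) (q ω).toNNReal g) *
          ENNReal.ofReal (Real.exp (-(g ^ 2 / 2))) *
            ENNReal.ofReal (Real.exp (g * η ω))) ∂P := by
        refine lintegral_lintegral_swap (Measurable.aemeasurable ?_)
        refine (hW₁m'.comp measurable_fst).mul ((hφ'.mul ?_).mul ?_)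
        · fun_prop
        · fun_prop
    -- For fixed `g` the weight is past-measurable, and the sub-Gaussian bound exp(g²/2) cancels the
    -- factor exp(-g²/2).
    _ ≤ ∫⁻ g, ∫⁻ ω, W₁ ω * ENNReal.ofReal (gaussianPDFReal (a ω) (q ω).toNNReal g) ∂P := by
        refine lintegral_mono fun g => ?_
        have hφg : Measurable[m] fun ω =>
            ENNReal.ofReal (gaussianPDFReal (a ω) (q ω).toNNReal g) :=
          hφ.comp (measurable_id.prodMk measurable_const)
        have := hη.lintegral_mul_exp_le hm g ((hW₁m.mul hφg).mul_const
          (ENNReal.ofReal (Real.exp (-(g ^ 2 / 2)))))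
        simp only [← mul_assoc]
        refine this.trans_eq ?_
        rw [lintegral_mul_const _ ((hW₁m.mul hφg).mono hm le_rfl), mul_assoc,
          ← ENNReal.ofReal_mul (Real.exp_pos _).le, ← Real.exp_add]
        simp
    _ = ∫⁻ ω, (∫⁻ g, W₁ ω * ENNReal.ofReal (gaussianPDFReal (a ω) (q ω).toNNReal g)) ∂P := by
        refine (lintegral_lintegral_swap (Measurable.aemeasurable ?_)).symm
        exact (hW₁m'.comp measurable_fst).mul hφ'
    _ = _ := by
        rw [← lintegral_indicator hA.compl]
        refine lintegral_congr fun ω => ?_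
        rw [lintegral_const_mul _ (measurable_gaussianPDFReal _ _).ennreal_ofReal]
        by_cases h : q ω = 0
        · simp [hW₁, h]
        · rw [lintegral_gaussianPDFReal_eq_one, mul_one]
          simpa using lt_of_le_of_ne (hq0 ω) (Ne.symm h)

end SelfNormalized

/-! ### Measurability of the design quantities -/

section Measurability

variable {Ω : Type*} [MeasurableSpace Ω] {d : ℕ} {x : ℕ → Ω → EuclideanSpace ℝ (Fin d)} {t : ℕ}

lemma measurable_designMatrix_apply (lam : ℝ) (hx : ∀ s < t, Measurable (x s)) (i j : Fin d) :
    Measurable fun ω => designMatrix lam (fun s => x s ω) t i j := by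
  simp only [designMatrix_apply]
  refine measurable_const.add (Finset.measurable_sum _ fun s hs => ?_)
  have := hx s (Finset.mem_range.1 hs)
  exact Measurable.mul (by fun_prop) (by fun_prop)

lemma measurable_comp_designMatrix (lam : ℝ) (hx : ∀ s < t, Measurable (x s))
    {f : Matrix (Fin d) (Fin d) ℝ → ℝ} (hf : Continuous f) :
    Measurable fun ω => f (designMatrix lam (fun s => x s ω) t) := by
  have h1 : Continuous fun A : Fin d → Fin d → ℝ => f (Matrix.of A) := hf.comp continuous_id
  have h2 : Measurable fun ω => fun i j => designMatrix lam (fun s => x s ω) t i j :=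
    measurable_pi_lambda _ fun i => measurable_pi_lambda _ fun j =>
      measurable_designMatrix_apply lam hx i j
  exact h1.measurable.comp h2

lemma measurable_detRatio (lam : ℝ) (hx : ∀ s < t, Measurable (x s)) :
    Measurable fun ω => detRatio lam (fun s => x s ω) t :=
  (measurable_comp_designMatrix lam hx (f := Matrix.det) (by fun_prop)).div_const _

lemma measurable_dotProduct_inv_designMatrix (lam : ℝ) (hx : ∀ s < t, Measurable (x s))
    {u v : Ω → EuclideanSpace ℝ (Fin d)} (hu : Measurable u) (hv : Measurable v) :
    Measurable fun ω =>
      (u ω).ofLp ⬝ᵥ ((designMatrix lam (fun s => x s ω) t)⁻¹ *ᵥ (v ω).ofLp) := by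
  simp only [dotProduct, Matrix.mulVec]
  have hinv : ∀ i j, Measurable fun ω => (designMatrix lam (fun s => x s ω) t)⁻¹ i j := by
    intro i j
    -- Writing the inverse through determinant and adjugate gives measurability without
    -- invertibility.
    simp only [Matrix.inv_def, Matrix.smul_apply, Ring.inverse_eq_inv', smul_eq_mul]
    refine (measurable_comp_designMatrix lam hx (f := Matrix.det) (by fun_prop)).inv.mul ?_
    exact measurable_comp_designMatrix lam hx (f := fun A => A.adjugate i j)
      (continuous_id.matrix_adjugate.matrix_elem i j)
  refine Finset.measurable_sum _ fun i _ => Measurable.mul (by fun_prop) ?_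
  exact Finset.measurable_sum _ fun j _ => (hinv i j).mul (by fun_prop)

lemma measurable_noiseVector {η : ℕ → Ω → ℝ} (hx : ∀ s < t, Measurable (x s))
    (hη : ∀ s < t, Measurable (η s)) :
    Measurable fun ω => noiseVector (fun s => x s ω) (fun s => η s ω) t := by
  refine Finset.measurable_sum _ fun s hs => ?_
  exact (hη s (Finset.mem_range.1 hs)).smul (hx s (Finset.mem_range.1 hs))

lemma measurable_weightedNorm_noiseVector (lam : ℝ) {η : ℕ → Ω → ℝ}
    (hx : ∀ s < t, Measurable (x s)) (hη : ∀ s < t, Measurable (η s)) :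
    Measurable fun ω => weightedNorm (designMatrix lam (fun s => x s ω) t)⁻¹
      (noiseVector (fun s => x s ω) (fun s => η s ω) t) :=
  (measurable_dotProduct_inv_designMatrix lam hx (measurable_noiseVector hx hη)
    (measurable_noiseVector hx hη)).sqrt

end Measurability

/-! ### Exponential moment of the self-normalized noise -/

section ExponentialMoment

variable {Ω : Type*} {mΩ : MeasurableSpace Ω} {P : Measure Ω} {d : ℕ}

lemma noiseVector_const_mul (x : ℕ → EuclideanSpace ℝ (Fin d)) (η : ℕ → ℝ) (c : ℝ) (t : ℕ) :
    noiseVector x (fun s => c * η s) t = c • noiseVector x η t := by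
  simp [noiseVector, Finset.smul_sum, mul_smul]

lemma weightedNorm_smul (A : Matrix (Fin d) (Fin d) ℝ) (c : ℝ) (v : EuclideanSpace ℝ (Fin d)) :
    weightedNorm A (c • v) = |c| * weightedNorm A v := by
  have : (c • v).ofLp ⬝ᵥ (A *ᵥ (c • v).ofLp) = c ^ 2 * (v.ofLp ⬝ᵥ (A *ᵥ v.ofLp)) := by
    simp only [WithLp.ofLp_smul, Matrix.mulVec_smul, dotProduct_smul, smul_dotProduct, smul_eq_mul]
    ring
  rw [weightedNorm, this, Real.sqrt_mul (sq_nonneg c), Real.sqrt_sq_eq_abs]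
  rfl

/-- The self-normalized exponential process `exp (‖S_t‖²_{V_t⁻¹} / 2) (det (lam I) / det V_t)^{1/2}`. -/
noncomputable def selfNormalizedExp (lam : ℝ) (x : ℕ → EuclideanSpace ℝ (Fin d)) (η : ℕ → ℝ)
    (t : ℕ) : ℝ :=
  Real.exp (weightedNorm (designMatrix lam x t)⁻¹ (noiseVector x η t) ^ 2 / 2) /
    √(detRatio lam x t)

lemma selfNormalizedExp_nonneg (lam : ℝ) (x : ℕ → EuclideanSpace ℝ (Fin d)) (η : ℕ → ℝ) (t : ℕ) :
    0 ≤ selfNormalizedExp lam x η t := by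
  unfold selfNormalizedExp
  positivity

lemma selfNormalizedExp_succ {lam : ℝ} (hlam : 0 < lam) (x : ℕ → EuclideanSpace ℝ (Fin d))
    (η : ℕ → ℝ) (t : ℕ) :
    selfNormalizedExp lam x η (t + 1) = selfNormalizedExp lam x η t *
      (Real.exp ((2 * η t * ((x t).ofLp ⬝ᵥ
            ((designMatrix lam x t)⁻¹ *ᵥ (noiseVector x η t).ofLp)) +
          η t ^ 2 * ((x t).ofLp ⬝ᵥ ((designMatrix lam x t)⁻¹ *ᵥ (x t).ofLp)) -
          ((x t).ofLp ⬝ᵥ ((designMatrix lam x t)⁻¹ *ᵥ (noiseVector x η t).ofLp)) ^ 2) /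
          (2 * (1 + (x t).ofLp ⬝ᵥ ((designMatrix lam x t)⁻¹ *ᵥ (x t).ofLp)))) /
        √(1 + (x t).ofLp ⬝ᵥ ((designMatrix lam x t)⁻¹ *ᵥ (x t).ofLp))) := by
  have hV := designMatrix_posDef hlam x t
  rw [selfNormalizedExp, weightedNorm_inv_sq hlam, designMatrix_succ, noiseVector_succ,
    dotProduct_inv_add_vecMulVec_mulVec_add_smul hV, detRatio_succ hlam,
    Real.sqrt_mul (detRatio_pos hlam t).le, selfNormalizedExp, weightedNorm_inv_sq hlam,
    div_mul_div_comm, ← Real.exp_add, add_div _ _ (2 : ℝ), div_div, mul_comm _ (2 : ℝ)]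

lemma measurable_selfNormalizedExp {m : MeasurableSpace Ω} (lam : ℝ)
    {x : ℕ → Ω → EuclideanSpace ℝ (Fin d)} {η : ℕ → Ω → ℝ} {t : ℕ}
    (hx : ∀ s < t, Measurable (x s)) (hη : ∀ s < t, Measurable (η s)) :
    Measurable fun ω => selfNormalizedExp lam (fun s => x s ω) (fun s => η s ω) t :=
  (((measurable_weightedNorm_noiseVector lam hx hη).pow_const 2).div_const 2).exp.div
    (measurable_detRatio lam hx).sqrt

/-- Induction on `t`: the process up to `t` is `ℱ t`-measurable and serves as the weight `W` in the
one-step inequality. -/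
lemma lintegral_selfNormalizedExp_le_one [IsProbabilityMeasure P] {ℱ : Filtration ℕ mΩ}
    {lam : ℝ} (hlam : 0 < lam) {x : ℕ → Ω → EuclideanSpace ℝ (Fin d)} {η : ℕ → Ω → ℝ} {T : ℕ}
    (hx : ∀ t < T, Measurable[ℱ t] (x t)) (hη : ∀ t < T, Measurable[ℱ (t + 1)] (η t))
    (hsub : ∀ t < T, CondSubGaussian (ℱ t) P (η t) 1) {t : ℕ} (ht : t ≤ T) :
    ∫⁻ ω, ENNReal.ofReal (selfNormalizedExp lam (fun s => x s ω) (fun s => η s ω) t) ∂P ≤ 1 := by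
  induction t with
  | zero =>
    simp [selfNormalizedExp, noiseVector, detRatio_zero hlam, weightedNorm]
  | succ t ih =>
    have htT : t < T := ht
    have hx' : ∀ s < t, Measurable[ℱ t] (x s) := fun s hs =>
      (hx s (hs.trans htT)).mono (ℱ.mono hs.le) le_rfl
    have hη' : ∀ s < t, Measurable[ℱ t] (η s) := fun s hs =>
      (hη s (hs.trans htT)).mono (ℱ.mono hs) le_rfl
    refine le_trans ?_ (ih htT.le)
    simp only [selfNormalizedExp_succ hlam, ENNReal.ofReal_mul (selfNormalizedExp_nonneg _ _ _ _)]
    refine (hsub t htT).lintegral_mul_exp_div_sqrt_le (ℱ.le t)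
      ((hη t htT).mono (ℱ.le _) le_rfl)
      (@measurable_selfNormalizedExp Ω d (ℱ t) lam x η t hx' hη').ennreal_ofReal
      (@measurable_dotProduct_inv_designMatrix Ω (ℱ t) d x t lam hx' _ _ (hx t htT)
        (@measurable_noiseVector Ω (ℱ t) d x t η hx' hη'))
      (@measurable_dotProduct_inv_designMatrix Ω (ℱ t) d x t lam hx' _ _ (hx t htT) (hx t htT))
      (fun ω => dotProduct_inv_mulVec_nonneg (designMatrix_posDef hlam _ t) _) fun ω h0 => ?_
    -- A zero width forces a zero arm, as V⁻¹ is positive definite; hence `a = 0` wherever `q = 0`.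
    have hz : (x t ω).ofLp = 0 := by
      by_contra hne
      have := (designMatrix_posDef hlam (fun s => x s ω) t).inv.dotProduct_mulVec_pos hne
      simp [h0] at this
    simp [hz]

lemma CondSubGaussian.inv_mul {m : MeasurableSpace Ω} {η : Ω → ℝ} {R : ℝ} (hR : R ≠ 0)
    (h : CondSubGaussian m P η R) : CondSubGaussian m P (fun ω => R⁻¹ * η ω) 1 := by
  intro s
  have := h (s * R⁻¹)
  have e : (s * R⁻¹) ^ 2 * R ^ 2 / 2 = s ^ 2 * 1 ^ 2 / 2 := by field_simp
  simpa only [e, mul_assoc] using this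

/-- With l the logarithm and z = N²/2 - l, the last term is exp(z), and N² = 2l + 2z ≤ 2l + exp(z)²
≤ (√(2l) + exp(z))². -/
lemma le_sqrt_add_selfNormalizedExp {lam : ℝ} (hlam : 0 < lam)
    (x : ℕ → EuclideanSpace ℝ (Fin d)) (η : ℕ → ℝ) (t : ℕ) {T : ℝ} (hT : 1 ≤ T) :
    weightedNorm (designMatrix lam x t)⁻¹ (noiseVector x η t) ≤
      √(2 * Real.log (√(detRatio lam x t) / (1 / T))) + selfNormalizedExp lam x η t / T := by
  have hT0 : 0 < T := by linarith
  have hr : 0 < √(detRatio lam x t) := Real.sqrt_pos.2 (detRatio_pos hlam t)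
  have hr1 : 1 ≤ √(detRatio lam x t) := Real.one_le_sqrt.2 (one_le_detRatio hlam t)
  rw [selfNormalizedExp]
  set N := weightedNorm (designMatrix lam x t)⁻¹ (noiseVector x η t)
  have hN : 0 ≤ N := weightedNorm_nonneg _ _
  set r := √(detRatio lam x t)
  have hl0 : 0 ≤ Real.log (r / (1 / T)) := by
    apply Real.log_nonneg
    rw [one_div, div_inv_eq_mul]
    nlinarith
  have hE : Real.exp (N ^ 2 / 2) / r / T = Real.exp (N ^ 2 / 2 - Real.log (r / (1 / T))) := by
    rw [Real.exp_sub, Real.exp_log (by positivity)]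
    field_simp
  rw [hE]
  set l := Real.log (r / (1 / T))
  set z := N ^ 2 / 2 - l with hz
  have hs0 := Real.sqrt_nonneg (2 * l)
  refine abs_le_of_sq_le_sq' ?_ (by positivity) |>.2
  have hs := Real.sq_sqrt (show 0 ≤ 2 * l by positivity)
  have h2 : 2 * z ≤ Real.exp z ^ 2 := by
    rw [← Real.exp_nat_mul]
    have := Real.add_one_le_exp (2 * z)
    push_cast
    linarith
  nlinarith [mul_nonneg hs0 (Real.exp_pos z).le]

/-- The amount by which the noise leaves the confidence ellipsoid of level
`1 / T` has expectation at most `R / T`. -/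
lemma exists_excess [IsProbabilityMeasure P] {ℱ : Filtration ℕ mΩ}
    {lam : ℝ} (hlam : 0 < lam) {x : ℕ → Ω → EuclideanSpace ℝ (Fin d)} {η : ℕ → Ω → ℝ} {T : ℕ}
    {R : ℝ} (hR : 0 ≤ R)
    (hx : ∀ t < T, Measurable[ℱ t] (x t)) (hη : ∀ t < T, Measurable[ℱ (t + 1)] (η t))
    (hsub : ∀ t < T, CondSubGaussian (ℱ t) P (η t) R) {t : ℕ} (ht : t < T) :
    ∃ e : Ω → ℝ, (∀ ω, 0 ≤ e ω) ∧ Integrable e P ∧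
      ∫ ω, e ω ∂P ≤ (if t = 0 then 0 else R / T) ∧
      ∀ᵐ ω ∂P, weightedNorm (designMatrix lam (fun s => x s ω) t)⁻¹
          (noiseVector (fun s => x s ω) (fun s => η s ω) t) ≤
        R * √(2 * Real.log (√(detRatio lam (fun s => x s ω) t) / (1 / (T : ℝ)))) + e ω := by
  have hT1 : (1 : ℝ) ≤ T := by exact_mod_cast (Nat.zero_le t).trans_lt ht
  -- Round 0 has no noise yet and needs no excess. This saving matters when T = 1, see
  -- `sum_ite_le_mul_sqrt`.
  rcases eq_or_ne t 0 with rfl | ht0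
  · refine ⟨0, fun _ => le_rfl, integrable_zero _ _ _, by simp, Filter.Eventually.of_forall ?_⟩
    intro ω
    simp [noiseVector, weightedNorm]
    positivity
  rcases hR.eq_or_lt with rfl | hR0
  · refine ⟨0, fun _ => le_rfl, integrable_zero _ _ _, by simp, ?_⟩
    have hz : ∀ᵐ ω ∂P, ∀ s < t, η s ω = 0 := by
      refine ae_all_iff.2 fun s => ?_
      by_cases hs : s < t
      · filter_upwards [(hsub s (hs.trans ht)).ae_eq_zero (ℱ.le s)] with ω hω _ using hω
      · exact Filter.Eventually.of_forall fun ω h => absurd h hs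
    filter_upwards [hz] with ω hω
    have : noiseVector (fun s => x s ω) (fun s => η s ω) t = 0 :=
      Finset.sum_eq_zero fun s hs => by simp [hω s (Finset.mem_range.1 hs)]
    simp [this, weightedNorm]
  · set M : Ω → ℝ := fun ω =>
      selfNormalizedExp lam (fun s => x s ω) (fun s => R⁻¹ * η s ω) t with hM
    have hM0 : ∀ ω, 0 ≤ M ω := fun ω => selfNormalizedExp_nonneg _ _ _ _
    have hlint : ∫⁻ ω, ENNReal.ofReal (M ω) ∂P ≤ 1 :=
      lintegral_selfNormalizedExp_le_one hlam hx (fun s hs => (hη s hs).const_mul R⁻¹)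
        (fun s hs => (hsub s hs).inv_mul hR0.ne') ht.le
    have hMm : Measurable M := measurable_selfNormalizedExp lam
      (fun s hs => (hx s (hs.trans ht)).mono (ℱ.le _) le_rfl)
      (fun s hs => ((hη s (hs.trans ht)).mono (ℱ.le _) le_rfl).const_mul R⁻¹)
    have hMi : Integrable M P := by
      refine ⟨hMm.aestronglyMeasurable, ?_⟩
      rw [hasFiniteIntegral_iff_ofReal (Filter.Eventually.of_forall hM0)]
      exact hlint.trans_lt ENNReal.one_lt_top
    have hMint : ∫ ω, M ω ∂P ≤ 1 := by
      rw [integral_eq_lintegral_of_nonneg_ae (Filter.Eventually.of_forall hM0)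
        hMm.aestronglyMeasurable]
      exact ENNReal.toReal_le_of_le_ofReal zero_le_one (by simpa using hlint)
    -- Scaling the pointwise inequality for R⁻¹ η back by `R` turns its last term M/T into this
    -- excess.
    refine ⟨fun ω => R / T * M ω, fun ω => mul_nonneg (by positivity) (hM0 ω),
      hMi.const_mul _, ?_, Filter.Eventually.of_forall fun ω => ?_⟩
    · rw [integral_const_mul, if_neg ht0]
      exact mul_le_of_le_one_right (by positivity) hMint
    · have := le_sqrt_add_selfNormalizedExp hlam (fun s => x s ω) (fun s => R⁻¹ * η s ω) t hT1
      rw [noiseVector_const_mul, weightedNorm_smul, abs_of_pos (inv_pos.2 hR0),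
        inv_mul_le_iff₀ hR0] at this
      refine this.trans_eq ?_
      simp only [hM]
      ring

end ExponentialMoment

/-! ### Elliptical potential and the regret of a run -/

section Regret

variable {d : ℕ} {lam L : ℝ} {x : ℕ → EuclideanSpace ℝ (Fin d)} {T : ℕ}

/-- Bernoulli's inequality (1 + u)^m ≥ 1 + m u with m = max 1 L. -/
lemma log_one_add_mul_le {u : ℝ} (hu : 0 ≤ u) (L : ℝ) :
    Real.log (1 + u * max 1 L) ≤ max 1 L * Real.log (1 + u) := by
  have hm : 1 ≤ max 1 L := le_max_left _ _
  rw [← Real.log_rpow (by linarith)]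
  refine Real.log_le_log (by positivity) ?_
  have := one_add_mul_self_le_rpow_one_add (s := u) (by linarith) hm
  linarith

/-- The determinant-trace bound has `L ^ 2` inside the logarithm; trading it for `L` costs one
factor max 1 L. -/
lemma log_detRatio_le_max_mul (hd : 1 ≤ d) (hlam : 0 < lam) (hL : 0 ≤ L)
    (hx : ∀ s < T, ‖x s‖ ≤ L) {t : ℕ} (ht : t ≤ T) :
    Real.log (detRatio lam x t) ≤ max 1 L * (d * Real.log (1 + T * L / (lam * d))) := by
  have hd0 : (0 : ℝ) < d := by exact_mod_cast hd
  have hu : 0 ≤ T * L / (lam * d) := by positivity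
  calc _ ≤ Real.log (detRatio lam x T) := log_detRatio_mono hlam ht
    _ ≤ d * Real.log (1 + T * L ^ 2 / (lam * d)) := log_detRatio_le hd hlam hx
    _ ≤ d * Real.log (1 + T * L / (lam * d) * max 1 L) := by
        refine mul_le_mul_of_nonneg_left (Real.log_le_log (by positivity) ?_) hd0.le
        have := mul_le_mul_of_nonneg_left (le_max_right 1 L) hu
        calc _ = 1 + T * L / (lam * d) * L := by ring
          _ ≤ _ := by linarith
    _ ≤ d * (max 1 L * Real.log (1 + T * L / (lam * d))) :=
        mul_le_mul_of_nonneg_left (log_one_add_mul_le hu L) hd0.le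
    _ = _ := by ring

/-- The elliptical potential lemma. -/
lemma sum_weightedNorm_sq_le (hd : 1 ≤ d) (hlam : 1 ≤ lam) (hL : 0 ≤ L)
    (hx : ∀ s < T, ‖x s‖ ≤ L) :
    ∑ t ∈ Finset.range T, weightedNorm (designMatrix lam x t)⁻¹ (x t) ^ 2 ≤
      2 * max 1 L ^ 3 * (d * Real.log (1 + T * L / (lam * d))) := by
  have hlam0 : 0 < lam := by linarith
  have hm : 1 ≤ max 1 L := le_max_left _ _
  calc _ ≤ ∑ t ∈ Finset.range T, 2 * max 1 L ^ 2 *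
        Real.log (1 + (x t).ofLp ⬝ᵥ ((designMatrix lam x t)⁻¹ *ᵥ (x t).ofLp)) := by
        refine Finset.sum_le_sum fun t ht => ?_
        have hq0 := dotProduct_inv_mulVec_nonneg (designMatrix_posDef hlam0 x t) (x t).ofLp
        have hq := dotProduct_inv_designMatrix_le (x := x) hlam0 t (x t)
        rw [weightedNorm_inv_sq hlam0]
        set q := (x t).ofLp ⬝ᵥ ((designMatrix lam x t)⁻¹ *ᵥ (x t).ofLp)
        have hqm : q ≤ max 1 L ^ 2 := by
          refine hq.trans ((div_le_self (sq_nonneg _) hlam).trans ?_)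
          exact pow_le_pow_left₀ (norm_nonneg _)
            ((hx t (Finset.mem_range.1 ht)).trans (le_max_right _ _)) 2
        -- From q/(1+q) ≤ log(1+q) and 1 + q ≤ 2 (max 1 L)²; the latter uses `1 ≤ lam`.
        have hlog := Real.one_sub_inv_le_log_of_pos (show 0 < 1 + q by linarith)
        refine le_trans ?_ (mul_le_mul_of_nonneg_left hlog (by positivity))
        have : 1 - (1 + q)⁻¹ = q / (1 + q) := by field_simp; ring
        rw [this, ← mul_div_assoc, le_div_iff₀ (by linarith), mul_comm]
        exact mul_le_mul_of_nonneg_right (by linarith [one_le_pow₀ (n := 2) hm]) hq0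
    _ = 2 * max 1 L ^ 2 * Real.log (detRatio lam x T) := by
        rw [← Finset.mul_sum, sum_log_one_add_eq_log_detRatio hlam0]
    _ ≤ 2 * max 1 L ^ 2 * (max 1 L * (d * Real.log (1 + T * L / (lam * d)))) :=
        mul_le_mul_of_nonneg_left (log_detRatio_le_max_mul hd hlam0 hL hx le_rfl) (by positivity)
    _ = _ := by ring

lemma log_add_sq_mul_div (hT : 1 ≤ T) (hlam : 0 < lam) (hL : 0 ≤ L) (d : ℕ) :
    Real.log (T + T ^ 2 * L / (lam * d)) =
      Real.log T + Real.log (1 + T * L / (lam * d)) := by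
  have hT0 : (0 : ℝ) < T := by exact_mod_cast hT
  rw [← Real.log_mul hT0.ne' (by positivity)]
  congr 1
  ring

lemma confidenceRadius_le (hd : 1 ≤ d) (hT : 1 ≤ T) (hlam : 0 < lam) (hL : 0 ≤ L)
    (hx : ∀ s < T, ‖x s‖ ≤ L) {R : ℝ} (hR : 0 ≤ R) (h w : EuclideanSpace ℝ (Fin d))
    {t : ℕ} (ht : t ≤ T) :
    confidenceRadius lam R (1 / (T : ℝ)) h w x t ≤ √(3 * max 1 L) *
      (√lam * ‖w - h‖ + R * √(d * Real.log (T + T ^ 2 * L / (lam * d)))) := by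
  have hT1 : (1 : ℝ) ≤ T := by exact_mod_cast hT
  have hd1 : (1 : ℝ) ≤ d := by exact_mod_cast hd
  have hm : 1 ≤ max 1 L := le_max_left _ _
  have hlT : 0 ≤ Real.log T := Real.log_nonneg hT1
  have hl : 0 ≤ Real.log (1 + T * L / (lam * d)) :=
    Real.log_nonneg (by linarith [show 0 ≤ T * L / (lam * d) by positivity])
  have hr := detRatio_pos (x := x) hlam t
  have hlog : 2 * Real.log (√(detRatio lam x t) / (1 / T)) ≤
      3 * max 1 L * (d * Real.log (T + T ^ 2 * L / (lam * d))) := by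
    rw [one_div, div_inv_eq_mul, Real.log_mul (Real.sqrt_pos.2 hr).ne' (by positivity),
      Real.log_sqrt hr.le, log_add_sq_mul_div hT hlam hL]
    have h1 := log_detRatio_le_max_mul hd hlam hL hx ht
    have h2 : Real.log T ≤ max 1 L * (d * Real.log T) := by
      have : 1 ≤ max 1 L * d := by nlinarith
      nlinarith
    have h3 : 0 ≤ max 1 L * (d * Real.log (1 + T * L / (lam * d))) := by positivity
    have h4 : 0 ≤ max 1 L * (d * Real.log T) := by positivity
    linarith
  have hs1 : 1 ≤ √(3 * max 1 L) := Real.one_le_sqrt.2 (by linarith)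
  rw [confidenceRadius_eq hlam, norm_sub_rev, mul_add]
  refine add_le_add (le_mul_of_one_le_left (by positivity) hs1) ?_
  rw [mul_left_comm, ← Real.sqrt_mul (by positivity)]
  gcongr

/-- The regret bound along a single run, with the excesses `e t` of the noise over the confidence
ellipsoids. -/
lemma pseudoRegret_le (hd : 1 ≤ d) (hT : 1 ≤ T) (hlam : 1 ≤ lam) (hL : 0 ≤ L) {R : ℝ}
    (hR : 0 ≤ R) {h w : EuclideanSpace ℝ (Fin d)} {η y e : ℕ → ℝ}
    {D : ℕ → Set (EuclideanSpace ℝ (Fin d))} {xstar : ℕ → EuclideanSpace ℝ (Fin d)}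
    (hD : ∀ t < T, ∀ a ∈ D t, ‖a‖ ≤ L) (hy : ∀ t < T, y t = inner ℝ (x t) w + η t)
    (hxs : ∀ t < T, xstar t ∈ D t)
    (hrun : IsBiasOFULRun lam R (1 / (T : ℝ)) h w T D x y) (he0 : ∀ t < T, 0 ≤ e t)
    (he : ∀ t < T, weightedNorm (designMatrix lam x t)⁻¹ (noiseVector x η t) ≤
      R * √(2 * Real.log (√(detRatio lam x t) / (1 / (T : ℝ)))) + e t) :
    pseudoRegret w T xstar x ≤
      2 * √6 * max 1 L ^ 2 * √(T * d * Real.log (1 + T * L / (lam * d))) *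
        (√lam * ‖w - h‖ + R * √(d * Real.log (T + T ^ 2 * L / (lam * d)))) +
      2 * (L / √lam) * ∑ t ∈ Finset.range T, e t := by
  have hlam0 : 0 < lam := by linarith
  have hm : 1 ≤ max 1 L := le_max_left _ _
  have hx : ∀ t < T, ‖x t‖ ≤ L := fun t ht => hD t ht _ (hrun t ht).1
  set B := √lam * ‖w - h‖ + R * √(d * Real.log (T + T ^ 2 * L / (lam * d))) with hB
  have hB0 : 0 ≤ B := by positivity
  set K := d * Real.log (1 + T * L / (lam * d)) with hK
  have hround : ∀ t ∈ Finset.range T, inner ℝ (xstar t - x t) w ≤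
      2 * (√(3 * max 1 L) * B) * weightedNorm (designMatrix lam x t)⁻¹ (x t) +
        2 * (L / √lam) * e t := by
    intro t ht
    have ht' := Finset.mem_range.1 ht
    have h1 := inner_sub_le_of_isMaxOn (x := x) hlam0 (fun s hs => hy s (hs.trans ht'))
      (he0 t ht') (he t ht') (hD t ht') (hrun t ht').1 (hrun t ht').2 (hxs t ht')
    have h2 := mul_le_mul_of_nonneg_right
      (confidenceRadius_le hd hT hlam0 hL hx hR h w ht'.le)
      (weightedNorm_nonneg (designMatrix lam x t)⁻¹ (x t))
    linarith
  have hsum : ∑ t ∈ Finset.range T, weightedNorm (designMatrix lam x t)⁻¹ (x t) ≤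
      √(2 * max 1 L ^ 3 * (T * K)) := by
    apply Real.le_sqrt_of_sq_le
    have h1 := sq_sum_le_card_mul_sum_sq (s := Finset.range T)
      (f := fun t => weightedNorm (designMatrix lam x t)⁻¹ (x t))
    rw [Finset.card_range] at h1
    have h2 := mul_le_mul_of_nonneg_left (sum_weightedNorm_sq_le hd hlam hL hx)
      (Nat.cast_nonneg T)
    linarith
  -- The radius contributes √(max 1 L) and the widths √(max 1 L ^ 3): together the square in the
  -- final constant.
  have hsq : √(3 * max 1 L) * √(2 * max 1 L ^ 3 * (T * K)) =
      √6 * max 1 L ^ 2 * √(T * d * Real.log (1 + T * L / (lam * d))) := by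
    rw [← Real.sqrt_mul (by positivity),
      show 3 * max 1 L * (2 * max 1 L ^ 3 * (T * K)) = 6 * (max 1 L ^ 2) ^ 2 *
        (T * d * Real.log (1 + T * L / (lam * d))) by rw [hK]; ring,
      Real.sqrt_mul (by positivity), Real.sqrt_mul (by positivity), Real.sqrt_sq (by positivity)]
  calc pseudoRegret w T xstar x ≤ ∑ t ∈ Finset.range T,
        (2 * (√(3 * max 1 L) * B) * weightedNorm (designMatrix lam x t)⁻¹ (x t) +
          2 * (L / √lam) * e t) := Finset.sum_le_sum hround
    _ = 2 * (√(3 * max 1 L) * B) *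
          ∑ t ∈ Finset.range T, weightedNorm (designMatrix lam x t)⁻¹ (x t) +
        2 * (L / √lam) * ∑ t ∈ Finset.range T, e t := by
        rw [Finset.sum_add_distrib, Finset.mul_sum, Finset.mul_sum]
    _ ≤ 2 * (√(3 * max 1 L) * B) * √(2 * max 1 L ^ 3 * (T * K)) +
        2 * (L / √lam) * ∑ t ∈ Finset.range T, e t := by gcongr
    _ = _ := by
        rw [show 2 * (√(3 * max 1 L) * B) * √(2 * max 1 L ^ 3 * (T * K)) =
          2 * (√(3 * max 1 L) * √(2 * max 1 L ^ 3 * (T * K))) * B by ring, hsq]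
        ring

/-- Since log(1+u) ≥ u/(1+u), the main factor never drops below a multiple of the price `L / √lam`
of a unit of excess, even for small `L`. -/
lemma div_sqrt_le_max_sq_mul_sqrt (hd : 1 ≤ d) (hT : 1 ≤ T) (hlam : 1 ≤ lam) (hL : 0 ≤ L) :
    L / √lam ≤ √2 * (max 1 L ^ 2 * √(T * d * Real.log (1 + T * L / (lam * d)))) := by
  have hlam0 : 0 < lam := by linarith
  have hT1 : (1 : ℝ) ≤ T := by exact_mod_cast hT
  have hd1 : (1 : ℝ) ≤ d := by exact_mod_cast hd
  have hm : 1 ≤ max 1 L := le_max_left _ _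
  have hLm : L ≤ max 1 L := le_max_right _ _
  have hlog := Real.one_sub_inv_le_log_of_pos (show 0 < 1 + T * L / (lam * d) by positivity)
  have hfrac : 1 - (1 + T * L / (lam * d))⁻¹ = T * L / (lam * d + T * L) := by
    field_simp
    ring
  rw [hfrac] at hlog
  have hsq : max 1 L ^ 2 = √((max 1 L ^ 2) ^ 2) := (Real.sqrt_sq (by positivity)).symm
  rw [hsq, ← Real.sqrt_mul (by positivity), ← Real.sqrt_mul (by positivity)]
  nth_rewrite 1 [← Real.sqrt_sq hL]
  rw [← Real.sqrt_div (sq_nonneg L)]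
  apply Real.sqrt_le_sqrt
  refine le_trans ?_ (mul_le_mul_of_nonneg_left (mul_le_mul_of_nonneg_left
    (mul_le_mul_of_nonneg_left hlog (by positivity)) (by positivity)) zero_le_two)
  set m := max 1 L
  have hden : 0 < lam * d + T * L := by positivity
  rw [show 2 * ((m ^ 2) ^ 2 * (T * d * (T * L / (lam * d + T * L)))) =
    2 * (m ^ 4 * (T ^ 2 * d * L)) / (lam * d + T * L) by ring, div_le_div_iff₀ hlam0 hden]
  have hm4 : 1 ≤ m ^ 4 := one_le_pow₀ hm
  have hLm4 : L ^ 2 ≤ m ^ 4 := by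
    calc L ^ 2 ≤ m ^ 2 := pow_le_pow_left₀ hL hLm 2
      _ ≤ m ^ 4 := pow_le_pow_right₀ hm (by norm_num)
  have hT2 : (T : ℝ) ≤ T ^ 2 := by nlinarith
  have hT3 : (1 : ℝ) ≤ T ^ 2 := by nlinarith
  have hLm4' : L ≤ m ^ 4 := hLm.trans (le_self_pow₀ hm (by norm_num))
  have h1 : L ^ 2 * (lam * d) ≤ m ^ 4 * (T ^ 2 * d * L) * lam := by
    calc L ^ 2 * (lam * d) = L * 1 * (d * L * lam) := by ring
      _ ≤ m ^ 4 * T ^ 2 * (d * L * lam) := by gcongr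
      _ = _ := by ring
  have h2 : L ^ 2 * (T * L) ≤ m ^ 4 * (T ^ 2 * d * L) * lam := by
    calc L ^ 2 * (T * L) = L ^ 2 * T * L * 1 * 1 := by ring
      _ ≤ m ^ 4 * T ^ 2 * L * d * lam := by gcongr
      _ = _ := by ring
  linarith

/-- The sum is R (1 - 1/T), and (1 - 1/T)² ≤ 1 - 1/T ≤ log T. A full sum `R` would fail for T = 1
and small `L`. -/
lemma sum_ite_le_mul_sqrt (hd : 1 ≤ d) (hT : 1 ≤ T) (hlam : 0 < lam) (hL : 0 ≤ L) {R : ℝ}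
    (hR : 0 ≤ R) :
    ∑ t ∈ Finset.range T, (if t = 0 then 0 else R / T) ≤
      R * √(d * Real.log (T + T ^ 2 * L / (lam * d))) := by
  have hT1 : (1 : ℝ) ≤ T := by exact_mod_cast hT
  have hT0 : (0 : ℝ) < T := by linarith
  have hd1 : (1 : ℝ) ≤ d := by exact_mod_cast hd
  obtain ⟨n, rfl⟩ := Nat.exists_eq_add_of_le' hT
  rw [Finset.sum_range_succ']
  simp only [Nat.add_eq_zero_iff, one_ne_zero, and_false, if_false, if_true, add_zero,
    Finset.sum_const, Finset.card_range, nsmul_eq_mul]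
  have hl : 0 ≤ Real.log (1 + ((n + 1 : ℕ) : ℝ) * L / (lam * d)) :=
    Real.log_nonneg (by linarith [show 0 ≤ ((n + 1 : ℕ) : ℝ) * L / (lam * d) by positivity])
  have hlog := Real.one_sub_inv_le_log_of_pos hT0
  have hn : (n : ℝ) = (n + 1 : ℕ) - 1 := by push_cast; ring
  set T' : ℝ := ((n + 1 : ℕ) : ℝ)
  have h1 : n * (R / T') = R * (1 - T'⁻¹) := by rw [hn]; field_simp
  rw [h1]
  refine mul_le_mul_of_nonneg_left ?_ hR
  apply Real.le_sqrt_of_sq_le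
  have hi0 : 0 ≤ 1 - T'⁻¹ := by linarith [inv_le_one_of_one_le₀ hT1]
  have hi1 : 0 < T'⁻¹ := by positivity
  rw [log_add_sq_mul_div hT hlam hL]
  nlinarith

end Regret

end BiasOFUL

/-! ### The expected regret -/

theorem mainTheorem4 :
    ∃ C : ℝ, 0 < C ∧
      ∀ (d T : ℕ) (_hd : 1 ≤ d) (_hT : 1 ≤ T)
        (Ω : Type*) (mΩ : MeasurableSpace Ω) (P : Measure Ω) (_hP : IsProbabilityMeasure P)
        (ℱ : Filtration ℕ mΩ)
        (lam L R S : ℝ) (h wstar : EuclideanSpace ℝ (Fin d))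
        (D : ℕ → Ω → Set (EuclideanSpace ℝ (Fin d)))
        (x xstar : ℕ → Ω → EuclideanSpace ℝ (Fin d)) (η y : ℕ → Ω → ℝ)
        (_hlam : 1 ≤ lam) (_hR : 0 ≤ R)
        (_hh : ‖h‖ ≤ S) (_hw : ‖wstar‖ ≤ S)
        -- arms have norm at most `L` and mean reward in `[-1, 1]`
        (_hL : ∀ t < T, ∀ ω, ∀ a ∈ D t ω, ‖a‖ ≤ L)
        (_hrew : ∀ t < T, ∀ ω, ∀ a ∈ D t ω, inner ℝ a wstar ∈ Set.Icc (-1 : ℝ) 1)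
        -- the arm of a round depends on the past only; the noise is conditionally sub-Gaussian
        (_hx : ∀ t < T, StronglyMeasurable[ℱ t] (x t))
        (_hη : ∀ t < T, StronglyMeasurable[ℱ (t + 1)] (η t))
        (_hsub : ∀ t < T, BiasOFUL.CondSubGaussian (ℱ t) P (η t) R)
        (_hy : ∀ t < T, ∀ ω, y t ω = inner ℝ (x t ω) wstar + η t ω)
        -- `xstar` is the optimal policy
        (_hxsm : ∀ t < T, StronglyMeasurable (xstar t))
        (_hxs : ∀ t < T, ∀ ω, xstar t ω ∈ D t ω ∧
          IsMaxOn (fun a => inner ℝ a wstar) (D t ω) (xstar t ω))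
        -- `x` is BIAS-OFUL with fixed bias `h` and confidence level `δ = 1 / T`
        (_hrun : ∀ ω, BiasOFUL.IsBiasOFULRun lam R (1 / (T : ℝ)) h wstar T
          (fun t => D t ω) (fun t => x t ω) (fun t => y t ω)),
        Integrable (fun ω => BiasOFUL.pseudoRegret wstar T
          (fun t => xstar t ω) (fun t => x t ω)) P ∧
        ∫ ω, BiasOFUL.pseudoRegret wstar T (fun t => xstar t ω) (fun t => x t ω) ∂P ≤
          (C * max 1 L ^ 2) *
            Real.sqrt (T * d * Real.log (1 + T * L / (lam * d))) *
            (Real.sqrt lam * ‖wstar - h‖ +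
              R * Real.sqrt (d * Real.log (T + T ^ 2 * L / (lam * d)))) := by
  -- 8 = 5 + 3, from 2√6 ≤ 5 for the main term and 2√2 ≤ 3 for the excess.
  refine ⟨8, by norm_num, ?_⟩
  intro d T hd hT Ω mΩ P hP ℱ lam L R S h wstar D x xstar η y hlam hR _ _ hL hrew hx hη hsub hy
    hxsm hxs hrun
  have hlam0 : 0 < lam := by linarith
  -- As T ≥ 1 and Ω is nonempty, the first decision set contains an arm.
  have hL0 : 0 ≤ L := by
    obtain ⟨ω⟩ := nonempty_of_isProbabilityMeasure P
    exact (norm_nonneg _).trans (hL 0 hT ω _ (hxs 0 hT ω).1)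
  have hint : Integrable (fun ω => BiasOFUL.pseudoRegret wstar T
      (fun t => xstar t ω) (fun t => x t ω)) P := by
    refine integrable_finsetSum _ fun t ht => ?_
    have ht' := Finset.mem_range.1 ht
    refine Integrable.of_bound (C := 2) ?_ (Filter.Eventually.of_forall fun ω => ?_)
    · exact (((hxsm t ht').sub ((hx t ht').mono (ℱ.le t))).inner
        stronglyMeasurable_const).aestronglyMeasurable
    · have h1 := hrew t ht' ω _ (hxs t ht' ω).1
      have h2 := hrew t ht' ω _ (hrun ω t ht').1
      rw [inner_sub_left, Real.norm_eq_abs, abs_le]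
      constructor <;> linarith [h1.1, h1.2, h2.1, h2.2]
  refine ⟨hint, ?_⟩
  -- Stated for all `t`, with the dummy excess 0 from `T` on, so that `choose` gives one family.
  have hex : ∀ t : ℕ, ∃ e : Ω → ℝ, t < T → (∀ ω, 0 ≤ e ω) ∧ Integrable e P ∧
      ∫ ω, e ω ∂P ≤ (if t = 0 then 0 else R / T) ∧
      ∀ᵐ ω ∂P, BiasOFUL.weightedNorm (BiasOFUL.designMatrix lam (fun s => x s ω) t)⁻¹
          (BiasOFUL.noiseVector (fun s => x s ω) (fun s => η s ω) t) ≤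
        R * √(2 * Real.log (√(BiasOFUL.detRatio lam (fun s => x s ω) t) / (1 / (T : ℝ)))) +
          e ω := by
    intro t
    by_cases ht : t < T
    · obtain ⟨e, he⟩ := BiasOFUL.exists_excess (P := P) (ℱ := ℱ) hlam0 hR
        (fun t ht => (hx t ht).measurable) (fun t ht => (hη t ht).measurable) hsub ht
      exact ⟨e, fun _ => he⟩
    · exact ⟨0, fun h => absurd h ht⟩
  choose e he using hex
  set ℓ := Real.log (1 + T * L / (lam * d)) with hℓ
  set N := R * √(d * Real.log (T + T ^ 2 * L / (lam * d))) with hN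
  have hN0 : 0 ≤ N := by positivity
  set A := max 1 L ^ 2 * √(T * d * ℓ) with hA
  have hA0 : 0 ≤ A := by positivity
  have hpt : ∀ᵐ ω ∂P, BiasOFUL.pseudoRegret wstar T (fun t => xstar t ω) (fun t => x t ω) ≤
      2 * √6 * A * (√lam * ‖wstar - h‖ + N) +
        2 * (L / √lam) * ∑ t ∈ Finset.range T, e t ω := by
    have hall : ∀ᵐ ω ∂P, ∀ t, t < T →
        BiasOFUL.weightedNorm (BiasOFUL.designMatrix lam (fun s => x s ω) t)⁻¹
          (BiasOFUL.noiseVector (fun s => x s ω) (fun s => η s ω) t) ≤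
        R * √(2 * Real.log (√(BiasOFUL.detRatio lam (fun s => x s ω) t) / (1 / (T : ℝ)))) +
          e t ω := by
      refine ae_all_iff.2 fun t => ?_
      by_cases ht : t < T
      · filter_upwards [(he t ht).2.2.2] with ω hω _ using hω
      · exact Filter.Eventually.of_forall fun ω h => absurd h ht
    filter_upwards [hall] with ω hω
    refine (BiasOFUL.pseudoRegret_le hd hT hlam hL0 hR (fun t ht => hL t ht ω)
      (fun t ht => hy t ht ω) (fun t ht => (hxs t ht ω).1) (hrun ω)
      (fun t ht => (he t ht).1 ω) hω).trans_eq ?_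
    ring
  have hei : ∀ t ∈ Finset.range T, Integrable (e t) P := fun t ht =>
    (he t (Finset.mem_range.1 ht)).2.1
  have hesum : Integrable (fun ω => ∑ t ∈ Finset.range T, e t ω) P :=
    integrable_finsetSum _ hei
  have heint : ∫ ω, ∑ t ∈ Finset.range T, e t ω ∂P ≤ N := by
    rw [integral_finsetSum _ hei]
    exact (Finset.sum_le_sum fun t ht => (he t (Finset.mem_range.1 ht)).2.2.1).trans
      (BiasOFUL.sum_ite_le_mul_sqrt hd hT hlam0 hL0 hR)
  have hLA : L / √lam ≤ √2 * A := BiasOFUL.div_sqrt_le_max_sq_mul_sqrt hd hT hlam hL0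
  have h6 : √6 ≤ 5 / 2 := Real.sqrt_le_iff.2 (by norm_num)
  have h2 : √2 ≤ 3 / 2 := Real.sqrt_le_iff.2 (by norm_num)
  calc _ ≤ ∫ ω, (2 * √6 * A * (√lam * ‖wstar - h‖ + N) +
        2 * (L / √lam) * ∑ t ∈ Finset.range T, e t ω) ∂P :=
        integral_mono_ae hint ((integrable_const _).add (hesum.const_mul _)) hpt
    _ = 2 * √6 * A * (√lam * ‖wstar - h‖ + N) +
        2 * (L / √lam) * ∫ ω, ∑ t ∈ Finset.range T, e t ω ∂P := by
        rw [integral_add (integrable_const _) (hesum.const_mul _), integral_const,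
          probReal_univ, one_smul, integral_const_mul]
    _ ≤ 2 * (5 / 2) * A * (√lam * ‖wstar - h‖ + N) + 2 * (3 / 2 * A) * N := by
        have hI : 0 ≤ ∫ ω, ∑ t ∈ Finset.range T, e t ω ∂P := integral_nonneg fun ω =>
          Finset.sum_nonneg fun t ht => (he t (Finset.mem_range.1 ht)).1 ω
        have h3 : L / √lam ≤ 3 / 2 * A := hLA.trans (by gcongr)
        gcongr
    _ ≤ 8 * A * (√lam * ‖wstar - h‖ + N) := by
        have : 0 ≤ A * (√lam * ‖wstar - h‖) := by positivity
        nlinarith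
    _ = _ := by
        rw [hA]
        ring
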